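/- Let $(\Omega,\mathcal F,\mathbb P)$ be a probability space and, for $N\ge 1$, let $(a_{N,k})_{0\le k\le N}$ be complex random variables on it with $\mathbb P\{a_{N,0}=0\}=\mathbb P\{a_{N,N}=0\}=0$ for all $N\ge 1$. No independence is assumed. Let $P_N(Z)=\sum_{k=0}^N a_{N,k}Z^k$ and $$L_N=\log\Big(\sum_{k=0}^N|a_{N,k}|\Big)-\tfrac12\log|a_{N,0}|-\tfrac12\log|a_{N,N}| .$$ Counting zeros with multiplicity, for $0\le\rho\le1$ let $\nu_N(\rho)$ be the number of zeros $z$ of $P_N$ with $1-\rho\le|z|\le\frac1{1-\rho}$ (where $\frac1{1-\rho}=\infty$ if $\rho=1$), and for $0\le\theta<\phi\le2\pi$ let $\nu_N(\theta,\phi)$ be the number of zeros $z$ of $P_N$ with $\theta\le\arg z<\phi$, where $\arg z\in[0,2\pi)$. The quantities $\frac1N\nu_N(\rho)$ and $\frac1N\nu_N(\theta,\phi)$ are integrable for all $N\ge1$, and the following hold. (1) If $\mathbb E[L_N]=o(N)$ as $N\to\infty$ (in particular $L_N$ is integrable for all large $N$), then there is a deterministic sequence $(\alpha_N)_{N\ge1}$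 with $0<\alpha_N\le N$ for all $N$ and $\alpha_N=o(N)$, such that $$\lim_{N\to\infty}\mathbb E\Big[\tfrac1N\nu_N\big(\tfrac{\alpha_N}{N}\big)\Big]=1,$$ and for all $0\le\theta<\phi\le2\pi$ $$\lim_{N\to\infty}\mathbb E\Big[\tfrac1N\nu_N(\theta,\phi)\Big]=\frac{\phi-\theta}{2\pi}.$$ Moreover $\frac1N\nu_N(\frac{\alpha_N}N)\to1$ and $\frac1N\nu_N(\theta,\phi)\to\frac{\phi-\theta}{2\pi}$ in probability and in the $p$-th mean for every real $p>0$. (2) If $(\alpha_N)_{N\ge1}$ is a deterministic sequence with $0<\alpha_N\le N$ for all $N$ such that $L_N=o(\alpha_N)$ almost surely as $N\to\infty$, then $\frac1N\nu_N(\frac{\alpha_N}N)\to1$ and, for all $0\le\theta<\phi\le2\pi$, $\frac1N\nu_N(\theta,\phi)\to\frac{\phi-\theta}{2\pi}$, in both cases almost surely and in the $p$-th mean for every real $p>0$. -/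

import Mathlib

open MeasureTheory Filter Topology

namespace ZeroClustering

/-- The polynomial `∑_{k=0}^N a_k Z^k`. -/
noncomputable def poly (N : ℕ) (a : ℕ → ℂ) : Polynomial ℂ :=
  ∑ k ∈ Finset.range (N + 1), Polynomial.C (a k) * Polynomial.X ^ k

/-- `L_N = log (∑_{k=0}^N |a_k|) - (1/2) log |a_0| - (1/2) log |a_N|`. -/
noncomputable def logSize (N : ℕ) (a : ℕ → ℂ) : ℝ :=
  Real.log (∑ k ∈ Finset.range (N + 1), ‖a k‖)
    - (1 / 2) * Real.log ‖a 0‖ - (1 / 2) * Real.log ‖a N‖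

/-- The argument of a complex number, normalised to lie in `[0, 2π)`. -/
noncomputable def argTwoPi (z : ℂ) : ℝ :=
  toIcoMod Real.two_pi_pos 0 (Complex.arg z)

open Classical in
/-- The number of zeros of `P`, counted with multiplicity, in the closed annulus
`1 - ρ ≤ |z| ≤ 1 / (1 - ρ)`, where `0 ≤ ρ ≤ 1`.
For `ρ = 1` the outer radius is infinite, so there is no upper bound on `|z|`. -/
noncomputable def annulusCount (P : Polynomial ℂ) (ρ : ℝ) : ℕ :=
  P.roots.countP (fun z => 1 - ρ ≤ ‖z‖ ∧ (ρ < 1 → ‖z‖ ≤ 1 / (1 - ρ)))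

open Classical in
/-- The number of zeros of `P`, counted with multiplicity, in the sector `θ ≤ arg z < φ`,
where `0 ≤ θ < φ ≤ 2π` and `arg z ∈ [0, 2π)`. -/
noncomputable def sectorCount (P : Polynomial ℂ) (θ φ : ℝ) : ℕ :=
  P.roots.countP (fun z => θ ≤ argTwoPi z ∧ argTwoPi z < φ)

/-- `ν_N(ρ) / N` for the polynomial with coefficients `a_0, …, a_N`. -/
noncomputable def annulusFraction (N : ℕ) (a : ℕ → ℂ) (ρ : ℝ) : ℝ :=
  (annulusCount (poly N a) ρ : ℝ) / N

/-- `ν_N(θ, φ) / N` for the polynomial with coefficients `a_0, …, a_N`. -/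
noncomputable def sectorFraction (N : ℕ) (a : ℕ → ℂ) (θ φ : ℝ) : ℝ :=
  (sectorCount (poly N a) θ φ : ℝ) / N

/-- Convergence of `X_N` to the constant `c` in the `p`-th mean (`p > 0`):
the `L^p` (quasi-)norm of `X_N - c` tends to `0`. -/
def TendstoInMean {Ω : Type*} [MeasurableSpace Ω] (μ : Measure Ω)
    (X : ℕ → Ω → ℝ) (c p : ℝ) : Prop :=
  Tendsto (fun N => eLpNorm (fun ω => X N ω - c) (ENNReal.ofReal p) μ) atTop (𝓝 0)

end ZeroClustering

/-!
The proof is deterministic up to a soft last step. For a polynomial `P = ∑ a k * X ^ k` of degree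
`N` with `a 0 ≠ 0` and with zeros `z`, the size `L = logSize N a` controls the zeros in two ways.

* Radially: Jensen's formula, in the form of the Mahler measure, gives
  `log ‖a N‖ + ∑ log⁺ ‖z‖ ≤ log ∑ ‖a k‖`, and with `‖a 0‖ = ‖a N‖ * ∏ ‖z‖` this becomes
  `∑ |log ‖z‖| ≤ 2 L` (`sum_abs_log_norm_roots_le`). A zero outside the annulus of parameter `ρ`
  contributes at least `ρ` to the sum, so there are at most `2 L / ρ` such zeros
  (`mul_sub_annulusCount_le`).
* In angle: project the zeros radially to points `w` of the unit circle. As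
  `‖y - w‖² ‖z‖ ≤ ‖y - z‖²` for `‖y‖ = 1`, the product `∏ ‖y - w‖` is at most `exp L` on the unit
  circle (`prod_norm_sub_div_norm_le`). Hence the real part of `∑ log (1 - w y)` is at most `L` in
  the unit disc; the Borel–Carathéodory inequality bounds the function itself, and Cauchy's estimate
  bounds its Taylor coefficients, which are the power sums of the `w` up to constants. The `k`-th
  power sum is therefore `O_k(L)` (`norm_sum_pow_le`), and Weyl's criterion shows that the angles
  equidistribute as `L / N → 0` (`tendsto_sectorFraction`). This is phrased with a filter on the
  pairs `(N, a)`, so that one statement serves both pointwise limits and limits in probability.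

The fractions lie in `[0, 1]`, so convergence in measure implies convergence in every mean, and
Markov's inequality converts a bound on `E[L]` into convergence in measure.

The counts of zeros are measurable functions of the coefficients because annuli and sectors are
σ-compact: the polynomials of degree `N` with at least `m` zeros in a σ-compact set form a
continuous image of a σ-compact space of zeros and leading coefficients
(`isSigmaCompact_setOf_le_countP`).
-/

/-! ### The size of a polynomial and the moduli of its zeros -/

namespace ZeroClustering
open Polynomial

lemma coeff_poly (N : ℕ) (a : ℕ → ℂ) (k : ℕ) :
    (poly N a).coeff k = if k ≤ N then a k else 0 := by
  simp [poly, coeff_C_mul, coeff_X_pow]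

lemma natDegree_poly_le (N : ℕ) (a : ℕ → ℂ) : (poly N a).natDegree ≤ N := by
  rw [natDegree_le_iff_coeff_eq_zero]
  intro k hk
  simp [coeff_poly, not_le.mpr hk]

lemma natDegree_poly {N : ℕ} {a : ℕ → ℂ} (hN : a N ≠ 0) : (poly N a).natDegree = N :=
  le_antisymm (natDegree_poly_le N a) (le_natDegree_of_ne_zero (by simpa [coeff_poly]))

lemma leadingCoeff_poly {N : ℕ} {a : ℕ → ℂ} (hN : a N ≠ 0) : (poly N a).leadingCoeff = a N := by
  simp [leadingCoeff, natDegree_poly hN, coeff_poly]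

lemma card_roots_poly_le (N : ℕ) (a : ℕ → ℂ) : (poly N a).roots.card ≤ N :=
  (card_roots' _).trans (natDegree_poly_le N a)

lemma card_roots_poly {N : ℕ} {a : ℕ → ℂ} (hN : a N ≠ 0) : (poly N a).roots.card = N := by
  rw [← natDegree_poly hN, natDegree_poly hN]
  exact ((IsAlgClosed.splits (poly N a)).natDegree_eq_card_roots.symm).trans (natDegree_poly hN)

lemma eval_poly (N : ℕ) (a : ℕ → ℂ) (z : ℂ) :
    (poly N a).eval z = ∑ k ∈ Finset.range (N + 1), a k * z ^ k := by
  simp [poly, eval_finsetSum]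

lemma norm_eval_poly {N : ℕ} {a : ℕ → ℂ} (hN : a N ≠ 0) (z : ℂ) :
    ‖(poly N a).eval z‖ = ‖a N‖ * ((poly N a).roots.map fun w => ‖z - w‖).prod := by
  conv_lhs => rw [(IsAlgClosed.splits (poly N a)).eq_prod_roots]
  rw [leadingCoeff_poly hN, eval_mul, eval_C, norm_mul, eval_multiset_prod, Multiset.map_map]
  congr 1
  have h := map_multiset_prod (normHom : ℂ →*₀ ℝ)
    (Multiset.map (eval z ∘ fun w => X - C w) (poly N a).roots)
  rw [Multiset.map_map] at h
  refine h.trans (congrArg Multiset.prod (Multiset.map_congr rfl fun w _ => ?_))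
  simp

lemma norm_coeff_zero_eq {N : ℕ} {a : ℕ → ℂ} (hN : a N ≠ 0) :
    ‖a 0‖ = ‖a N‖ * ((poly N a).roots.map fun w => ‖w‖).prod := by
  have h := norm_eval_poly hN 0
  rw [← coeff_zero_eq_eval_zero] at h
  simpa [coeff_poly] using h

lemma ne_zero_of_mem_roots_poly {N : ℕ} {a : ℕ → ℂ} (h0 : a 0 ≠ 0) {z : ℂ}
    (hz : z ∈ (poly N a).roots) : z ≠ 0 := by
  rintro rfl
  have := (mem_roots'.1 hz).2
  rw [IsRoot, ← coeff_zero_eq_eval_zero] at this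
  simp [coeff_poly, h0] at this

lemma log_norm_coeff_zero_eq {N : ℕ} {a : ℕ → ℂ} (h0 : a 0 ≠ 0) (hN : a N ≠ 0) :
    Real.log ‖a 0‖ = Real.log ‖a N‖ + ((poly N a).roots.map fun w => Real.log ‖w‖).sum := by
  have hne : ∀ x ∈ (poly N a).roots.map (fun w => ‖w‖), x ≠ 0 := by
    intro x hx
    obtain ⟨w, hw, rfl⟩ := Multiset.mem_map.1 hx
    exact norm_ne_zero_iff.2 (ne_zero_of_mem_roots_poly h0 hw)
  rw [norm_coeff_zero_eq hN, Real.log_mul (norm_ne_zero_iff.2 hN) (Multiset.prod_ne_zero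
    fun h => hne 0 h rfl), Real.log_multiset_prod hne, Multiset.map_map]
  rfl

lemma sum_norm_pos {N : ℕ} {a : ℕ → ℂ} (hN : a N ≠ 0) :
    0 < ∑ k ∈ Finset.range (N + 1), ‖a k‖ :=
  (norm_pos_iff.2 hN).trans_le
    (Finset.single_le_sum (f := fun k => ‖a k‖) (fun _ _ => norm_nonneg _)
      (Finset.self_mem_range_succ N))

/-- The size `L_N` controls the total logarithmic distance of the zeros from the unit circle. -/
lemma sum_abs_log_norm_roots_le {N : ℕ} {a : ℕ → ℂ} (h0 : a 0 ≠ 0) (hN : a N ≠ 0) :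
    ((poly N a).roots.map fun z => |Real.log ‖z‖|).sum ≤ 2 * logSize N a := by
  have hsum : ((poly N a).sum fun _ b => ‖b‖) = ∑ k ∈ Finset.range (N + 1), ‖a k‖ := by
    rw [Polynomial.sum_over_range _ (by simp), natDegree_poly hN]
    exact Finset.sum_congr rfl fun k hk => by
      simp [coeff_poly, Nat.lt_succ_iff.1 (Finset.mem_range.1 hk)]
  have hp : poly N a ≠ 0 := fun h => hN (by simpa [h] using (leadingCoeff_poly hN).symm)
  have hM := logMahlerMeasure_eq_log_leadingCoeff_add_sum_log_roots (poly N a)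
  rw [logMahlerMeasure_eq_log_MahlerMeasure, leadingCoeff_poly hN] at hM
  have hle : Real.log (poly N a).mahlerMeasure ≤
      Real.log (∑ k ∈ Finset.range (N + 1), ‖a k‖) :=
    Real.log_le_log (mahlerMeasure_pos_of_ne_zero hp)
      (hsum ▸ mahlerMeasure_le_sum_norm_coeff (poly N a))
  -- `|x| = 2 x⁺ - x`, applied to `x = log ‖z‖`
  have habs : ((poly N a).roots.map fun z => |Real.log ‖z‖|).sum =
      2 * ((poly N a).roots.map fun z => Real.posLog ‖z‖).sum -
        ((poly N a).roots.map fun z => Real.log ‖z‖).sum := by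
    rw [← Multiset.sum_map_mul_left, ← Multiset.sum_map_sub]
    congr 1
    refine Multiset.map_congr rfl fun z _ => ?_
    rw [Real.posLog]
    rcases le_total 0 (Real.log ‖z‖) with h | h
    · rw [abs_of_nonneg h, max_eq_right h]; ring
    · rw [abs_of_nonpos h, max_eq_left h]; ring
  have := log_norm_coeff_zero_eq h0 hN
  rw [habs, logSize]
  linarith

lemma logSize_nonneg {N : ℕ} {a : ℕ → ℂ} (h0 : a 0 ≠ 0) (hN : a N ≠ 0) : 0 ≤ logSize N a := by
  have h := sum_abs_log_norm_roots_le h0 hN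
  have : 0 ≤ ((poly N a).roots.map fun z => |Real.log ‖z‖|).sum :=
    Multiset.sum_nonneg fun x hx => by
      obtain ⟨z, _, rfl⟩ := Multiset.mem_map.1 hx
      exact abs_nonneg _
  linarith

lemma exp_two_mul_logSize {N : ℕ} {a : ℕ → ℂ} (h0 : a 0 ≠ 0) (hN : a N ≠ 0) :
    Real.exp (2 * logSize N a) * (‖a 0‖ * ‖a N‖) = (∑ k ∈ Finset.range (N + 1), ‖a k‖) ^ 2 := by
  have h0' := norm_pos_iff.2 h0
  have hN' := norm_pos_iff.2 hN
  have hS := sum_norm_pos hN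
  rw [← Real.exp_log (mul_pos h0' hN'), ← Real.exp_add, Real.log_mul h0'.ne' hN'.ne',
    ← Real.exp_log (pow_pos hS 2), Real.log_pow, logSize]
  congr 1
  push_cast
  ring

/-- A root outside the annulus contributes at least `ρ` to the sum of `|log ‖z‖|`, which gives a
Markov-type bound on the number of such roots. -/
lemma mul_sub_annulusCount_le {N : ℕ} {a : ℕ → ℂ} (h0 : a 0 ≠ 0) (hN : a N ≠ 0) (ρ : ℝ) :
    ρ * (N - annulusCount (poly N a) ρ) ≤ 2 * logSize N a := by
  classical
  set A : ℂ → Prop := fun z => 1 - ρ ≤ ‖z‖ ∧ (ρ < 1 → ‖z‖ ≤ 1 / (1 - ρ)) with hA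
  have key : ∀ z : ℂ, z ≠ 0 → ρ * (if ¬ A z then 1 else 0) ≤ |Real.log ‖z‖| := by
    intro z hz
    by_cases h : A z
    · simp [h]
    have hz' := norm_pos_iff.2 hz
    rw [if_pos h, mul_one]
    simp only [hA, not_and_or, not_le, Classical.not_imp] at h
    rcases h with h | ⟨h1, h2⟩
    · have := Real.log_le_sub_one_of_pos hz'
      rw [le_abs]; right; linarith
    · have h3 : 0 < 1 - ρ := by linarith
      have h4 := Real.log_le_sub_one_of_pos h3
      have h5 := Real.log_lt_log (by positivity) h2
      rw [one_div, Real.log_inv] at h5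
      rw [le_abs]; left; linarith
  have hcount : ((N : ℝ) - annulusCount (poly N a) ρ) =
      ((poly N a).roots.map fun z => (if ¬ A z then (1 : ℝ) else 0)).sum := by
    have h1 : (poly N a).roots.countP A + (poly N a).roots.countP (fun z => ¬ A z) = N := by
      rw [← card_roots_poly hN, card_roots_poly hN, ← Multiset.card_eq_countP_add_countP A,
        card_roots_poly hN]
    have h2 : annulusCount (poly N a) ρ = (poly N a).roots.countP A := by
      unfold annulusCount
      convert rfl
    have h3 : ((poly N a).roots.map fun z => (if ¬ A z then (1 : ℝ) else 0)).sum =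
        (poly N a).roots.countP (fun z => ¬ A z) := by
      induction (poly N a).roots using Multiset.induction_on with
      | empty => simp
      | cons z s ih =>
        rw [Multiset.map_cons, Multiset.sum_cons, ih, Multiset.countP_cons]
        push_cast
        ring
    rw [h3, h2, sub_eq_iff_eq_add, ← Nat.cast_add, add_comm, h1]
  refine le_trans ?_ (sum_abs_log_norm_roots_le h0 hN)
  rw [hcount, ← Multiset.sum_map_mul_left]
  exact Multiset.sum_map_le_sum_map _ _ fun z hz => key z (ne_zero_of_mem_roots_poly h0 hz)

/-- Moving a point radially onto the unit circle shrinks its distance to a point of the unit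
circle, up to the factor `√‖w‖`. -/
lemma sq_norm_sub_div_norm_mul_le {z w : ℂ} (hz : ‖z‖ = 1) (hw : w ≠ 0) :
    ‖z - w / ‖w‖‖ ^ 2 * ‖w‖ ≤ ‖z - w‖ ^ 2 := by
  have hw' := norm_pos_iff.2 hw
  rw [@norm_sub_sq_real ℂ, @norm_sub_sq_real ℂ, norm_div, hz]
  have h1 : w / (‖w‖ : ℂ) = (‖w‖⁻¹ : ℝ) • w := by
    rw [Complex.real_smul]; push_cast; field_simp
  rw [h1, real_inner_smul_right, Complex.norm_real, norm_norm, div_self hw'.ne']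
  have h2 : (1 ^ 2 - 2 * (‖w‖⁻¹ * inner ℝ z w) + 1 ^ 2) * ‖w‖ = 2 * ‖w‖ - 2 * inner ℝ z w := by
    field_simp
    ring
  rw [h2]
  nlinarith [sq_nonneg (‖w‖ - 1)]

/-- The monic polynomial whose zeros are the radial projections of the zeros of `P_N` onto the unit
circle is bounded by `exp L_N` there. -/
lemma prod_norm_sub_div_norm_le {N : ℕ} {a : ℕ → ℂ} (h0 : a 0 ≠ 0) (hN : a N ≠ 0) {z : ℂ}
    (hz : ‖z‖ = 1) :
    ((poly N a).roots.map fun w => ‖z - w / ‖w‖‖).prod ≤ Real.exp (logSize N a) := by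
  set R := (poly N a).roots
  have h0' := norm_pos_iff.2 h0
  have hN' := norm_pos_iff.2 hN
  have hP : ‖(poly N a).eval z‖ ≤ ∑ k ∈ Finset.range (N + 1), ‖a k‖ := by
    rw [eval_poly]
    refine (norm_sum_le _ _).trans (le_of_eq (Finset.sum_congr rfl fun k _ => ?_))
    simp [hz]
  have h1 : (R.map fun w => ‖z - w / ‖w‖‖).prod ^ 2 * (R.map fun w => ‖w‖).prod ≤
      (R.map fun w => ‖z - w‖).prod ^ 2 := by
    rw [← Multiset.prod_map_pow, ← Multiset.prod_map_mul, ← Multiset.prod_map_pow]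
    exact Multiset.prod_map_le_prod_map₀ _ _ (fun w _ => by positivity)
      fun w hw => sq_norm_sub_div_norm_mul_le hz (ne_zero_of_mem_roots_poly h0 hw)
  have hE := exp_two_mul_logSize h0 hN
  have hc := norm_coeff_zero_eq hN
  have hn := norm_eval_poly hN z
  have h2 : (R.map fun w => ‖z - w / ‖w‖‖).prod ^ 2 * (‖a 0‖ * ‖a N‖) ≤
      Real.exp (2 * logSize N a) * (‖a 0‖ * ‖a N‖) := by
    rw [hE]
    calc _ = (R.map fun w => ‖z - w / ‖w‖‖).prod ^ 2 * (R.map fun w => ‖w‖).prod * ‖a N‖ ^ 2 := by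
          rw [hc]; ring
      _ ≤ (R.map fun w => ‖z - w‖).prod ^ 2 * ‖a N‖ ^ 2 := by gcongr
      _ = ‖(poly N a).eval z‖ ^ 2 := by rw [hn]; ring
      _ ≤ _ := by gcongr
  have h3 := le_of_mul_le_mul_right h2 (mul_pos h0' hN')
  rw [two_mul, Real.exp_add, ← sq] at h3
  exact le_of_sq_le_sq h3 (Real.exp_pos _).le

end ZeroClustering

/-! ### Power sums and equidistribution on the circle -/

namespace ZeroClustering
open AddCircle

lemma one_sub_mul_mem_slitPlane {w z : ℂ} (hw : ‖w‖ ≤ 1) (hz : ‖z‖ < 1) :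
    1 - w * z ∈ Complex.slitPlane := by
  refine Or.inl ?_
  have h1 : ‖w * z‖ < 1 := by
    rw [norm_mul]
    exact (mul_le_of_le_one_left (norm_nonneg z) hw).trans_lt hz
  have h2 := (Complex.re_le_norm (w * z)).trans_lt h1
  simp only [Complex.sub_re, Complex.one_re]
  linarith

lemma differentiableAt_log_one_sub_mul {w z : ℂ} (hw : ‖w‖ ≤ 1) (hz : ‖z‖ < 1) :
    DifferentiableAt ℂ (fun z => Complex.log (1 - w * z)) z :=
  DifferentiableAt.clog (by fun_prop) (one_sub_mul_mem_slitPlane hw hz)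

lemma iteratedDeriv_succ_log_one_sub_mul {w : ℂ} (hw : ‖w‖ ≤ 1) (k : ℕ) :
    ∀ z : ℂ, ‖z‖ < 1 → iteratedDeriv (k + 1) (fun z => Complex.log (1 - w * z)) z =
      -(k.factorial * w ^ (k + 1)) / (1 - w * z) ^ (k + 1) := by
  have haff (z : ℂ) : HasDerivAt (fun z => 1 - w * z) (-w) z := by
    simpa using ((hasDerivAt_id z).const_mul w).const_sub 1
  induction k with
  | zero =>
    intro z hz
    rw [zero_add, iteratedDeriv_one, ((haff z).clog (one_sub_mul_mem_slitPlane hw hz)).deriv]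
    simp
  | succ k ih =>
    intro z hz
    have hne := Complex.slitPlane_ne_zero (one_sub_mul_mem_slitPlane hw hz)
    have hev : iteratedDeriv (k + 1) (fun z => Complex.log (1 - w * z)) =ᶠ[𝓝 z]
        fun z => -(k.factorial * w ^ (k + 1)) / (1 - w * z) ^ (k + 1) := by
      filter_upwards [Metric.isOpen_ball.mem_nhds (mem_ball_zero_iff.2 hz)] with y hy
      exact ih y (mem_ball_zero_iff.1 hy)
    have hd := (hasDerivAt_const z (-(k.factorial * w ^ (k + 1) : ℂ))).div ((haff z).pow (k + 1))
      (pow_ne_zero _ hne)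
    rw [iteratedDeriv_succ, hev.deriv_eq]
    refine hd.deriv.trans ?_
    rw [Nat.factorial_succ]
    simp only [Nat.add_sub_cancel, Pi.pow_apply]
    push_cast
    field_simp
    ring

/-- The Taylor coefficients of `∑ log (1 - w z)` at `0` are, up to constants, the power sums of the
points `w`. -/
lemma iteratedDeriv_sum_log_one_sub_mul (W : Multiset ℂ) (hW : ∀ w ∈ W, ‖w‖ ≤ 1) (k : ℕ) :
    iteratedDeriv (k + 1) (fun z => (W.map fun w => Complex.log (1 - w * z)).sum) 0 =
      -(k.factorial * (W.map fun w => w ^ (k + 1)).sum) := by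
  induction W using Multiset.induction_on with
  | empty => simp
  | cons w W ih =>
    have hW' : ∀ v ∈ W, ‖v‖ ≤ 1 := fun v hv => hW v (Multiset.mem_cons_of_mem hv)
    have hw := hW w (Multiset.mem_cons_self w W)
    simp only [Multiset.map_cons, Multiset.sum_cons]
    have hball : Metric.ball (0 : ℂ) 1 ∈ 𝓝 0 := Metric.ball_mem_nhds 0 one_pos
    have h1 : AnalyticAt ℂ (fun z => Complex.log (1 - w * z)) 0 := by
      rw [Complex.analyticAt_iff_eventually_differentiableAt]
      filter_upwards [hball] with z hz
      exact differentiableAt_log_one_sub_mul hw (mem_ball_zero_iff.1 hz)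
    have h2 : AnalyticAt ℂ (fun z => (W.map fun w => Complex.log (1 - w * z)).sum) 0 := by
      clear ih
      induction W using Multiset.induction_on with
      | empty => simpa using analyticAt_const
      | cons v W ih =>
        simp only [Multiset.map_cons, Multiset.sum_cons]
        refine AnalyticAt.add ?_ (ih (fun u hu => hW u (by
          simp only [Multiset.mem_cons] at hu ⊢; tauto)) fun u hu =>
            hW' u (Multiset.mem_cons_of_mem hu))
        rw [Complex.analyticAt_iff_eventually_differentiableAt]
        filter_upwards [hball] with z hz
        exact differentiableAt_log_one_sub_mul (hW' v (Multiset.mem_cons_self v W))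
          (mem_ball_zero_iff.1 hz)
    rw [iteratedDeriv_fun_add h1.contDiffAt h2.contDiffAt, ih hW',
      iteratedDeriv_succ_log_one_sub_mul hw k 0 (by simp)]
    simp
    ring

/-- If `∏ ‖1 - w z‖` is at most `exp M` on the unit circle, where the points `w` lie in the closed
unit disc, then the power sums of these points are of order `M`: by the Borel–Carathéodory inequality
`∑ log (1 - w z)`, whose real part is at most `M`, is bounded by `2 M` on the disc of radius `1/2`,
and its Taylor coefficients obey Cauchy's estimate. -/
lemma norm_sum_pow_le {W : Multiset ℂ} (hW : ∀ w ∈ W, ‖w‖ ≤ 1) {M : ℝ} (hM : 0 < M)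
    (h : ∀ z : ℂ, ‖z‖ = 1 → (W.map fun w => ‖1 - w * z‖).prod ≤ Real.exp M) (k : ℕ) :
    ‖(W.map fun w => w ^ (k + 1)).sum‖ ≤ (k + 1) * 2 ^ (k + 2) * M := by
  set f : ℂ → ℂ := fun z => (W.map fun w => Complex.log (1 - w * z)).sum with hf
  set g : ℂ → ℂ := fun z => (W.map fun w => 1 - w * z).prod with hg
  have hnormg (z : ℂ) : ‖g z‖ = (W.map fun w => ‖1 - w * z‖).prod := by
    have := map_multiset_prod (normHom : ℂ →*₀ ℝ) (W.map fun w => 1 - w * z)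
    rw [Multiset.map_map] at this
    exact this
  have hgd : Differentiable ℂ g := by
    intro z
    simp only [hg]
    clear_value f
    clear hnormg hf hg g h hW
    induction W using Multiset.induction_on with
    | empty => simp
    | cons w W ih =>
      simp only [Multiset.map_cons, Multiset.prod_cons]
      exact DifferentiableAt.mul (by fun_prop) ih
  have hgle : ∀ z ∈ Metric.ball (0 : ℂ) 1, ‖g z‖ ≤ Real.exp M := fun z hz =>
    Complex.norm_le_of_forall_mem_frontier_norm_le Metric.isBounded_ball hgd.diffContOnCl
      (fun y hy => by
        rw [frontier_ball _ one_ne_zero, mem_sphere_zero_iff_norm] at hy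
        exact (hnormg y).trans_le (h y hy)) (subset_closure hz)
  have hfd : DifferentiableOn ℂ f (Metric.ball 0 1) := by
    intro z hz
    have hz' := mem_ball_zero_iff.1 hz
    refine DifferentiableAt.differentiableWithinAt ?_
    simp only [hf]
    clear_value f g
    clear hnormg hf hg hgd hgle g h f
    induction W using Multiset.induction_on with
    | empty => simp
    | cons w W ih =>
      simp only [Multiset.map_cons, Multiset.sum_cons]
      exact DifferentiableAt.add (differentiableAt_log_one_sub_mul
        (hW w (Multiset.mem_cons_self w W)) hz')
        (ih fun v hv => hW v (Multiset.mem_cons_of_mem hv))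
  have hexp : ∀ z ∈ Metric.ball (0 : ℂ) 1, Complex.exp (f z) = g z := by
    intro z hz
    rw [hf, hg, Complex.exp_multiset_sum, Multiset.map_map]
    exact congrArg Multiset.prod (Multiset.map_congr rfl fun w hw => Complex.exp_log
      (Complex.slitPlane_ne_zero (one_sub_mul_mem_slitPlane (hW w hw) (mem_ball_zero_iff.1 hz))))
  have hre : Set.MapsTo f (Metric.ball 0 1) {z | z.re ≤ M} := fun z hz => by
    have := hgle z hz
    rw [← hexp z hz, Complex.norm_exp] at this
    exact Real.exp_le_exp.1 this
  have hf0 : f 0 = 0 := by simp [hf]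
  have hbound : ∀ z ∈ Metric.sphere (0 : ℂ) (1 / 2), ‖f z‖ ≤ 2 * M := by
    intro z hz
    have hz' : ‖z‖ = 1 / 2 := mem_sphere_zero_iff_norm.1 hz
    have := Complex.borelCaratheodory_zero hM hfd hre one_pos
      (mem_ball_zero_iff.2 (by rw [hz']; norm_num)) hf0 (z := z)
    rw [hz'] at this
    refine this.trans (le_of_eq ?_)
    ring
  have hcauchy := Complex.norm_iteratedDeriv_le_of_forall_mem_sphere_norm_le (k + 1)
    (by norm_num : (0 : ℝ) < 1 / 2)
    ((hfd.mono (Metric.closedBall_subset_ball (by norm_num))).diffContOnCl_ball subset_rfl) hbound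
  rw [hf, iteratedDeriv_sum_log_one_sub_mul W hW k, norm_neg, norm_mul, Complex.norm_natCast,
    Nat.factorial_succ] at hcauchy
  have hk : (0 : ℝ) < k.factorial := by positivity
  refine le_of_mul_le_mul_left (hcauchy.trans (le_of_eq ?_)) hk
  rw [one_div, inv_pow, div_inv_eq_mul]
  push_cast
  ring

section Weyl
variable {T : ℝ} [Fact (0 < T)]

lemma norm_sum_map_div_card_le (S : Multiset (AddCircle T)) (f : C(AddCircle T, ℂ)) :
    ‖(S.map f).sum / S.card‖ ≤ ‖f‖ := by
  rcases Nat.eq_zero_or_pos S.card with h | h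
  · simp [h]
  rw [norm_div, Complex.norm_natCast, div_le_iff₀ (by exact_mod_cast h)]
  clear h
  induction S using Multiset.induction_on with
  | empty => simp
  | cons x S ih =>
    rw [Multiset.map_cons, Multiset.sum_cons, Multiset.card_cons]
    push_cast
    have := norm_add_le (f x) (S.map f).sum
    have := f.norm_coe_le_norm x
    linarith

/-- Weyl's equidistribution criterion, for a family of finite multisets of points. -/
theorem tendsto_average_of_tendsto_fourier {ι : Type*} {l : Filter ι}
    {S : ι → Multiset (AddCircle T)} (hS : ∀ᶠ i in l, (S i).card ≠ 0)
    (h : ∀ n : ℤ, n ≠ 0 → Tendsto (fun i => ((S i).map (fourier n)).sum / (S i).card) l (𝓝 0))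
    (f : C(AddCircle T, ℂ)) :
    Tendsto (fun i => ((S i).map f).sum / (S i).card) l (𝓝 (∫ x, f x ∂haarAddCircle)) := by
  have hint (f : C(AddCircle T, ℂ)) : Integrable f haarAddCircle :=
    f.continuous.integrable_of_hasCompactSupport (HasCompactSupport.of_compactSpace _)
  have hspan : ∀ f ∈ Submodule.span ℂ (Set.range (@fourier T)),
      Tendsto (fun i => ((S i).map f).sum / (S i).card) l (𝓝 (∫ x, f x ∂haarAddCircle)) := by
    intro f hf
    induction hf using Submodule.span_induction with
    | mem f hf =>
      obtain ⟨n, rfl⟩ := hf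
      by_cases hn : n = 0
      · subst hn
        simp only [fourier_zero, integral_const, probReal_univ, one_smul]
        refine tendsto_const_nhds.congr' ?_
        filter_upwards [hS] with i hi
        simp [hi]
      · have h0 : ∫ x, fourier n x ∂(haarAddCircle : Measure (AddCircle T)) = 0 := by
          have h1 := (orthonormal_iff_ite.1 (orthonormal_fourier (T := T))) 0 n
          rw [if_neg (Ne.symm hn), ContinuousMap.inner_toLp] at h1
          simpa using h1
        rw [h0]
        exact h n hn
    | zero => simpa using tendsto_const_nhds
    | add f g _ _ hf hg =>
      simp only [ContinuousMap.add_apply]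
      rw [integral_add (hint f) (hint g)]
      refine (hf.add hg).congr fun i => ?_
      rw [← add_div, ← Multiset.sum_map_add]
    | smul c f _ hf =>
      simp only [ContinuousMap.smul_apply, smul_eq_mul]
      rw [integral_const_mul]
      refine (hf.const_mul c).congr fun i => ?_
      rw [Multiset.sum_map_mul_left, mul_div_assoc]
  have hmem : f ∈ closure (Submodule.span ℂ (Set.range (@fourier T)) : Set C(AddCircle T, ℂ)) := by
    rw [← Submodule.topologicalClosure_coe, span_fourier_closure_eq_top]
    trivial
  rw [Metric.tendsto_nhds]
  intro ε hε
  obtain ⟨g, hg, hfg⟩ := Metric.mem_closure_iff.1 hmem (ε / 3) (by positivity)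
  rw [dist_eq_norm] at hfg
  filter_upwards [(Metric.tendsto_nhds.1 (hspan g hg)) (ε / 3) (by positivity)] with i hi
  have h1 : ‖((S i).map f).sum / (S i).card - ((S i).map g).sum / (S i).card‖ ≤ ‖f - g‖ := by
    refine le_trans (le_of_eq ?_) (norm_sum_map_div_card_le (S i) (f - g))
    rw [← sub_div, ← Multiset.sum_map_sub]
    rfl
  have h2 : ‖(∫ x, g x ∂haarAddCircle) - ∫ x, f x ∂haarAddCircle‖ ≤ ‖f - g‖ := by
    rw [← integral_sub (hint g) (hint f)]
    refine (norm_integral_le_of_norm_le_const (C := ‖f - g‖) (ae_of_all _ fun x => ?_)).trans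
      (by simp)
    rw [norm_sub_rev]
    exact (f - g).norm_coe_le_norm x
  rw [dist_eq_norm] at hi ⊢
  have h3 := norm_add₃_le
    (a := ((S i).map f).sum / (S i).card - ((S i).map g).sum / (S i).card)
    (b := ((S i).map g).sum / (S i).card - ∫ x, g x ∂haarAddCircle)
    (c := (∫ x, g x ∂haarAddCircle) - ∫ x, f x ∂haarAddCircle)
  rw [sub_add_sub_cancel, sub_add_sub_cancel] at h3
  linarith

open Classical in
/-- Equidistributed multisets asymptotically put at most its Haar measure into a closed set. -/
lemma eventually_countP_div_card_le {ι : Type*} {l : Filter ι}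
    {S : ι → Multiset (AddCircle T)} (hS : ∀ᶠ i in l, (S i).card ≠ 0)
    (h : ∀ n : ℤ, n ≠ 0 → Tendsto (fun i => ((S i).map (fourier n)).sum / (S i).card) l (𝓝 0))
    {F : Set (AddCircle T)} (hF : IsClosed F) {ε : ℝ} (hε : 0 < ε) :
    ∀ᶠ i in l, ((S i).countP (· ∈ F) : ℝ) / (S i).card ≤ haarAddCircle.real F + ε := by
  -- test the equidistribution on a continuous function which dominates the indicator of `F`
  have hlim := tendsto_integral_thickenedIndicator_of_isClosed
    (haarAddCircle : Measure (AddCircle T)) hF (δs := fun n : ℕ => 1 / ((n : ℝ) + 1))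
    (fun n => Nat.one_div_pos_of_nat) tendsto_one_div_add_atTop_nhds_zero_nat
  obtain ⟨n, hn⟩ := (hlim.eventually (gt_mem_nhds (lt_add_of_pos_right _ (half_pos hε)))).exists
  set t := thickenedIndicator (Nat.one_div_pos_of_nat (α := ℝ) (n := n)) F
  let f : C(AddCircle T, ℂ) := ⟨fun x => ((t x : ℝ) : ℂ), by fun_prop⟩
  have hf := tendsto_average_of_tendsto_fourier hS h f
  have hint : ∫ x, f x ∂haarAddCircle = ((∫ x, (t x : ℝ) ∂haarAddCircle : ℝ) : ℂ) :=
    integral_complex_ofReal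
  rw [hint] at hf
  have hf' := (Complex.continuous_re.tendsto _).comp hf
  filter_upwards [hf'.eventually_lt_const (u := haarAddCircle.real F + ε)
    (by rw [Complex.ofReal_re]; linarith)] with i hi
  refine le_trans ?_ hi.le
  have hre : (((S i).map f).sum / (S i).card).re =
      ((S i).map fun x => (t x : ℝ)).sum / (S i).card := by
    have : ((S i).map f).sum = (((S i).map fun x => (t x : ℝ)).sum : ℂ) := by
      have := map_multiset_sum Complex.ofRealHom ((S i).map fun x => (t x : ℝ))
      rw [Multiset.map_map] at this
      exact this.symm
    rw [this, ← Complex.ofReal_natCast, ← Complex.ofReal_div, Complex.ofReal_re]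
  rw [Function.comp_apply, hre]
  gcongr
  induction S i using Multiset.induction_on with
  | empty => simp
  | cons x s ih =>
    rw [Multiset.map_cons, Multiset.sum_cons, Multiset.countP_cons]
    push_cast
    rw [add_comm]
    refine add_le_add ?_ ih
    split_ifs with hx
    · simp [t, thickenedIndicator_one _ F hx]
    · simp

end Weyl
end ZeroClustering

/-! ### Equidistribution of the arguments of the zeros -/

namespace ZeroClustering
open AddCircle

instance fact_two_pi_pos : Fact (0 < 2 * Real.pi) := ⟨Real.two_pi_pos⟩

lemma coe_argTwoPi (z : ℂ) :
    ((argTwoPi z : ℝ) : AddCircle (2 * Real.pi)) = ((z.arg : ℝ) : AddCircle (2 * Real.pi)) := by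
  rw [argTwoPi, toIcoMod, sub_eq_add_neg, ← neg_smul, AddCircle.coe_add,
    AddCircle.coe_zsmul, AddCircle.coe_period, smul_zero, add_zero]

lemma argTwoPi_mem_Ico (z : ℂ) : argTwoPi z ∈ Set.Ico 0 (2 * Real.pi) := by
  simpa [argTwoPi] using toIcoMod_mem_Ico Real.two_pi_pos 0 z.arg

lemma fourier_coe_argTwoPi {z : ℂ} (hz : z ≠ 0) (n : ℕ) :
    fourier n ((argTwoPi z : ℝ) : AddCircle (2 * Real.pi)) = (z / ‖z‖) ^ n := by
  have hz' : (‖z‖ : ℂ) ≠ 0 := by simpa using hz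
  rw [coe_argTwoPi, fourier_coe_apply]
  have h : 2 * (Real.pi : ℂ) * Complex.I * (n : ℤ) * z.arg / ((2 * Real.pi : ℝ) : ℂ) =
      n * (z.arg * Complex.I) := by
    have : (Real.pi : ℂ) ≠ 0 := by exact_mod_cast Real.pi_ne_zero
    push_cast
    field_simp
  rw [h, Complex.exp_nat_mul]
  congr 1
  rw [eq_div_iff hz', mul_comm, Complex.norm_mul_exp_arg_mul_I]

/-- The arguments of the zeros of `P_N`, with multiplicity, as points of `ℝ / 2πℤ`. -/
noncomputable def rootAngles (N : ℕ) (a : ℕ → ℂ) : Multiset (AddCircle (2 * Real.pi)) :=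
  (poly N a).roots.map fun z => ((argTwoPi z : ℝ) : AddCircle (2 * Real.pi))

lemma card_rootAngles {N : ℕ} {a : ℕ → ℂ} (hN : a N ≠ 0) : (rootAngles N a).card = N := by
  rw [rootAngles, Multiset.card_map, card_roots_poly hN]

/-- Indeed `∑ ‖a k‖ ≥ ‖a 0‖ + ‖a N‖ ≥ 2 √(‖a 0‖ ‖a N‖)`. -/
lemma logSize_pos {N : ℕ} (hN1 : 1 ≤ N) {a : ℕ → ℂ} (h0 : a 0 ≠ 0) (hN : a N ≠ 0) :
    0 < logSize N a := by
  have h0' := norm_pos_iff.2 h0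
  have hN' := norm_pos_iff.2 hN
  have hS : ‖a 0‖ + ‖a N‖ ≤ ∑ k ∈ Finset.range (N + 1), ‖a k‖ := by
    rw [Finset.sum_range_succ]
    gcongr
    exact Finset.single_le_sum (f := fun k => ‖a k‖) (fun _ _ => norm_nonneg _)
      (Finset.mem_range.2 hN1)
  have hE := exp_two_mul_logSize h0 hN
  have h1 : 1 * (‖a 0‖ * ‖a N‖) < Real.exp (2 * logSize N a) * (‖a 0‖ * ‖a N‖) := by
    rw [hE]
    calc 1 * (‖a 0‖ * ‖a N‖) < (‖a 0‖ + ‖a N‖) ^ 2 := by nlinarith [mul_pos h0' hN']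
      _ ≤ _ := by gcongr
  have h2 := lt_of_mul_lt_mul_right h1 (mul_pos h0' hN').le
  rw [← Real.exp_zero, Real.exp_lt_exp] at h2
  linarith

/-- The nonzero Fourier coefficients of the distribution of the angles are bounded by the size of
the polynomial. -/
lemma norm_sum_fourier_rootAngles_le {N : ℕ} (hN1 : 1 ≤ N) {a : ℕ → ℂ} (h0 : a 0 ≠ 0)
    (hN : a N ≠ 0) (k : ℕ) :
    ‖((rootAngles N a).map (fourier ((k + 1 : ℕ) : ℤ))).sum‖ ≤
      (k + 1) * 2 ^ (k + 2) * logSize N a := by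
  set W := (poly N a).roots.map fun z => z / (‖z‖ : ℂ) with hWdef
  have hW : ∀ w ∈ W, ‖w‖ ≤ 1 := by
    intro w hw
    obtain ⟨z, _, rfl⟩ := Multiset.mem_map.1 hw
    rw [norm_div, Complex.norm_real, norm_norm]
    exact div_self_le_one _
  have hprod : ∀ y : ℂ, ‖y‖ = 1 →
      (W.map fun w => ‖1 - w * y‖).prod ≤ Real.exp (logSize N a) := by
    intro y hy
    have hy' : ‖(starRingEnd ℂ) y‖ = 1 := by rw [Complex.norm_conj, hy]
    refine le_trans (le_of_eq ?_) (prod_norm_sub_div_norm_le h0 hN hy')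
    rw [hWdef, Multiset.map_map]
    refine congrArg Multiset.prod (Multiset.map_congr rfl fun z _ => ?_)
    -- `‖1 - w y‖ = ‖conj y - w‖` since `conj y * y = 1`
    have h1 : (starRingEnd ℂ) y * y = 1 := by
      rw [mul_comm, Complex.mul_conj, Complex.normSq_eq_norm_sq, hy]; simp
    rw [Function.comp_apply, ← h1, ← sub_mul, norm_mul, hy, mul_one]
  have h := norm_sum_pow_le hW (logSize_pos hN1 h0 hN) hprod k
  refine le_trans (le_of_eq ?_) h
  rw [rootAngles, Multiset.map_map, hWdef, Multiset.map_map]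
  congr 2
  exact Multiset.map_congr rfl fun z hz =>
    fourier_coe_argTwoPi (ne_zero_of_mem_roots_poly h0 hz) (k + 1)

/-- The filter of pairs `(N, a)`, with `N ≥ 1` and `a 0, a N ≠ 0`, along which
`logSize N a / N` tends to `0`. -/
noncomputable def smallSize : Filter (ℕ × (ℕ → ℂ)) :=
  comap (fun p => logSize p.1 p.2 / p.1) (𝓝 0) ⊓ 𝓟 {p | 1 ≤ p.1 ∧ p.2 0 ≠ 0 ∧ p.2 p.1 ≠ 0}

lemma eventually_smallSize :
    ∀ᶠ p in smallSize, 1 ≤ p.1 ∧ p.2 0 ≠ 0 ∧ p.2 p.1 ≠ 0 :=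
  mem_inf_of_right (mem_principal_self _)

lemma tendsto_fourier_rootAngles (n : ℤ) (hn : n ≠ 0) :
    Tendsto (fun p : ℕ × (ℕ → ℂ) => ((rootAngles p.1 p.2).map (fourier n)).sum /
      (rootAngles p.1 p.2).card) smallSize (𝓝 0) := by
  have hpos (k : ℕ) : Tendsto (fun p : ℕ × (ℕ → ℂ) =>
      ((rootAngles p.1 p.2).map (fourier ((k + 1 : ℕ) : ℤ))).sum /
        (rootAngles p.1 p.2).card) smallSize (𝓝 0) := by
    have hlim : Tendsto (fun p : ℕ × (ℕ → ℂ) => (k + 1) * 2 ^ (k + 2) * (logSize p.1 p.2 / p.1))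
        smallSize (𝓝 0) := by
      have : Tendsto (fun p : ℕ × (ℕ → ℂ) => logSize p.1 p.2 / p.1) smallSize (𝓝 0) :=
        tendsto_comap.mono_left inf_le_left
      simpa using this.const_mul (((k : ℝ) + 1) * 2 ^ (k + 2))
    refine squeeze_zero_norm' ?_ hlim
    filter_upwards [eventually_smallSize] with p ⟨h1, h0, hN⟩
    rw [norm_div, Complex.norm_natCast, card_rootAngles hN, ← mul_div_assoc]
    gcongr
    exact norm_sum_fourier_rootAngles_le h1 h0 hN k
  obtain ⟨k, hk⟩ := Nat.exists_eq_succ_of_ne_zero (Int.natAbs_ne_zero.2 hn)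
  rcases Int.natAbs_eq n with h | h
  · rw [h, hk]
    exact hpos k
  · -- negative frequencies are complex conjugates of positive ones
    have hc := (Complex.continuous_conj.tendsto 0).comp (hpos k)
    rw [map_zero] at hc
    refine hc.congr fun p => ?_
    rw [h, hk, Function.comp_apply, map_div₀, Complex.conj_natCast, map_multiset_sum,
      Multiset.map_map]
    congr 2
    exact Multiset.map_congr rfl fun x _ => fourier_neg.symm

/-- Only the upper bound is needed: applied to a sector and to its complement, it determines the
limiting fraction of zeros. -/
lemma haarAddCircle_real_image_Icc_le {θ φ : ℝ} (h : θ ≤ φ) (h' : φ ≤ θ + 2 * Real.pi) :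
    (haarAddCircle : Measure (AddCircle (2 * Real.pi))).real
      ((fun x : ℝ => (x : AddCircle (2 * Real.pi))) '' Set.Icc θ φ) ≤
      (φ - θ) / (2 * Real.pi) := by
  have hT := Real.two_pi_pos
  set F := (fun x : ℝ => (x : AddCircle (2 * Real.pi))) '' Set.Icc θ φ
  have hF : IsClosed F :=
    (isCompact_Icc.image (AddCircle.continuous_mk' (2 * Real.pi))).isClosed
  have hvol : volume F ≤ ENNReal.ofReal (φ - θ) := by
    rw [AddCircle.add_projection_respects_measure (2 * Real.pi) θ hF.measurableSet]
    calc _ ≤ volume (Set.Icc θ φ ∪ {θ + 2 * Real.pi}) := by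
          refine measure_mono ?_
          rintro x ⟨⟨y, hy, hxy⟩, hx⟩
          -- a point of `(θ, θ + 2π]` congruent to one of `[θ, φ]` lies in `[θ, φ]` or is `θ + 2π`
          obtain ⟨n, hn⟩ := (AddCircle.coe_eq_zero_iff _).1
            (show ((x - y : ℝ) : AddCircle (2 * Real.pi)) = 0 by
              rw [AddCircle.coe_sub, sub_eq_zero]; exact hxy.symm)
          rw [zsmul_eq_mul] at hn
          have hn1 : -1 < n := by
            have : ((-1 : ℤ) : ℝ) < n := by
              push_cast
              nlinarith [hx.1, hy.2]
            exact_mod_cast this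
          have hn2 : n < 2 := by
            have : (n : ℝ) < ((2 : ℤ) : ℝ) := by
              push_cast
              nlinarith [hx.2, hy.1]
            exact_mod_cast this
          obtain rfl | rfl : n = 0 ∨ n = 1 := by omega
          · left
            have : x = y := by simp at hn; linarith
            exact this ▸ hy
          · right
            have h3 := hx.2
            have h4 := hy.1
            rw [Set.mem_singleton_iff]
            push_cast at hn
            linarith
      _ ≤ _ := (measure_union_le _ _).trans (by simp)
  have h2 : (volume : Measure (AddCircle (2 * Real.pi))).real F =
      2 * Real.pi * haarAddCircle.real F := by
    rw [volume_eq_smul_haarAddCircle, measureReal_ennreal_smul_apply,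
      ENNReal.toReal_ofReal hT.le]
  rw [le_div_iff₀ hT, mul_comm, ← h2]
  exact ENNReal.toReal_le_of_le_ofReal (by linarith) hvol

lemma eventually_sectorFraction_le {θ φ ε : ℝ} (h : θ ≤ φ) (h' : φ ≤ θ + 2 * Real.pi)
    (hε : 0 < ε) :
    ∀ᶠ p in smallSize, sectorFraction p.1 p.2 θ φ ≤ (φ - θ) / (2 * Real.pi) + ε := by
  classical
  have hF : IsClosed ((fun x : ℝ => (x : AddCircle (2 * Real.pi))) '' Set.Icc θ φ) :=
    (isCompact_Icc.image (AddCircle.continuous_mk' (2 * Real.pi))).isClosed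
  have hcard : ∀ᶠ p in smallSize, (rootAngles p.1 p.2).card ≠ 0 := by
    filter_upwards [eventually_smallSize] with p ⟨h1, _, hN⟩
    rw [card_rootAngles hN]
    omega
  filter_upwards [eventually_countP_div_card_le hcard tendsto_fourier_rootAngles hF hε,
    eventually_smallSize] with p hp ⟨_, _, hN⟩
  refine le_trans ?_ (hp.trans (by gcongr; exact haarAddCircle_real_image_Icc_le h h'))
  rw [card_rootAngles hN, sectorFraction]
  gcongr
  rw [sectorCount, rootAngles, Multiset.countP_map, Multiset.countP_eq_card_filter]
  refine Multiset.card_le_card (Multiset.monotone_filter_right _ fun z hz => ?_)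
  exact ⟨argTwoPi z, ⟨hz.1, hz.2.le⟩, rfl⟩

lemma sectorCount_add_sectorCount {N : ℕ} {a : ℕ → ℂ} (hN : a N ≠ 0) {θ φ : ℝ}
    (h1 : θ ≤ φ) :
    sectorCount (poly N a) 0 θ + sectorCount (poly N a) θ φ +
      sectorCount (poly N a) φ (2 * Real.pi) = N := by
  classical
  rw [← card_roots_poly hN, card_roots_poly hN]
  conv_rhs => rw [← card_roots_poly hN]
  simp only [sectorCount]
  induction (poly N a).roots using Multiset.induction_on with
  | empty => simp
  | cons z s ih =>
    have hz := argTwoPi_mem_Ico z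
    rw [Multiset.countP_cons, Multiset.countP_cons, Multiset.countP_cons, Multiset.card_cons, ← ih]
    have h3 : (if 0 ≤ argTwoPi z ∧ argTwoPi z < θ then 1 else 0) +
        (if θ ≤ argTwoPi z ∧ argTwoPi z < φ then 1 else 0) +
        (if φ ≤ argTwoPi z ∧ argTwoPi z < 2 * Real.pi then 1 else 0) = 1 := by
      rcases lt_or_ge (argTwoPi z) θ with h | h
      · simp [hz.1, h, h.not_ge, (h.trans_le h1).not_ge]
      · rcases lt_or_ge (argTwoPi z) φ with h' | h'
        · simp [h, h', h.not_gt, h'.not_ge]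
        · simp [hz.2, h, h', h.not_gt, h'.not_gt]
    omega

/-- Qualitative Erdős–Turán theorem: the fraction of zeros in a sector tends to its angular
proportion when `logSize N a / N` tends to `0`, uniformly in `N` and `a`. -/
theorem tendsto_sectorFraction {θ φ : ℝ} (h0 : 0 ≤ θ) (h1 : θ ≤ φ) (h2 : φ ≤ 2 * Real.pi) :
    Tendsto (fun p : ℕ × (ℕ → ℂ) => sectorFraction p.1 p.2 θ φ) smallSize
      (𝓝 ((φ - θ) / (2 * Real.pi))) := by
  rw [Metric.tendsto_nhds]
  intro ε hε
  -- the upper bounds for the complementary sectors give the lower bound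
  filter_upwards [eventually_sectorFraction_le h0 (by linarith) (half_pos (half_pos hε)),
    eventually_sectorFraction_le h1 (by linarith) (half_pos (half_pos hε)),
    eventually_sectorFraction_le h2 (by linarith) (half_pos (half_pos hε)),
    eventually_smallSize] with p hp1 hp2 hp3 ⟨hN1, _, hN⟩
  have hN' : (p.1 : ℝ) ≠ 0 := by positivity
  have hsum : sectorFraction p.1 p.2 0 θ + sectorFraction p.1 p.2 θ φ +
      sectorFraction p.1 p.2 φ (2 * Real.pi) = 1 := by
    rw [sectorFraction, sectorFraction, sectorFraction, ← add_div, ← add_div, div_eq_one_iff_eq hN']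
    exact_mod_cast sectorCount_add_sectorCount hN h1
  have hang : (θ - 0) / (2 * Real.pi) + (φ - θ) / (2 * Real.pi) +
      (2 * Real.pi - φ) / (2 * Real.pi) = 1 := by
    field_simp
    ring
  rw [Real.dist_eq, abs_lt]
  constructor <;> linarith

end ZeroClustering

/-! ### Measurability of the number of zeros -/

namespace ZeroClustering
open Polynomial

lemma exists_fin_map_eq {α : Type*} {n : ℕ} {s : Multiset α} (hs : s.card = n) :
    ∃ x : Fin n → α, (Finset.univ : Finset (Fin n)).val.map x = s := by
  induction s using Quotient.inductionOn with
  | h l =>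
    subst hs
    refine ⟨l.get, ?_⟩
    exact (Fin.univ_val_map l.get).trans (congrArg _ (List.ofFn_get l))

lemma continuous_coeff_mul {α : Type*} [TopologicalSpace α] {p q : α → ℂ[X]}
    (hp : ∀ k, Continuous fun t => (p t).coeff k) (hq : ∀ k, Continuous fun t => (q t).coeff k)
    (k : ℕ) : Continuous fun t => (p t * q t).coeff k := by
  simp only [coeff_mul]
  exact continuous_finsetSum _ fun i _ => (hp i.1).mul (hq i.2)

lemma continuous_coeff_prod {α ι : Type*} [TopologicalSpace α] (s : Finset ι) {p : ι → α → ℂ[X]}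
    (hp : ∀ i k, Continuous fun t => (p i t).coeff k) :
    ∀ k, Continuous fun t => (∏ i ∈ s, p i t).coeff k := by
  classical
  induction s using Finset.induction_on with
  | empty => intro k; simpa using continuous_const
  | insert i s hi ih =>
    simp only [Finset.prod_insert hi]
    exact continuous_coeff_mul (hp i) ih

lemma continuous_coeff_X_sub_C {α : Type*} [TopologicalSpace α] {f : α → ℂ} (hf : Continuous f)
    (k : ℕ) : Continuous fun t => (X - C (f t)).coeff k := by
  simp only [coeff_sub, coeff_X, coeff_C]
  split_ifs <;> fun_prop

/-- The sequence which agrees with `b` up to index `N` and vanishes afterwards. -/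
noncomputable def extendZero (N : ℕ) (b : Fin (N + 1) → ℂ) : ℕ → ℂ :=
  fun k => if h : k < N + 1 then b ⟨k, h⟩ else 0

/-- The set of coefficient vectors of polynomials of exact degree `N` with at least `m` zeros in a
σ-compact set `A` is a continuous image of the σ-compact space of admissible leading coefficients
and zeros. -/
lemma isSigmaCompact_setOf_le_countP {A : Set ℂ} (hA : IsSigmaCompact A) [DecidablePred (· ∈ A)]
    {N m : ℕ} (hm : m ≤ N) :
    IsSigmaCompact {b : Fin (N + 1) → ℂ | b (Fin.last N) ≠ 0 ∧
      m ≤ (poly N (extendZero N b)).roots.countP (· ∈ A)} := by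
  have : SigmaCompactSpace A := isSigmaCompact_iff_sigmaCompactSpace.1 hA
  have hopen : IsOpen {c : ℂ | c ≠ 0} := isOpen_ne
  have : LocallyCompactSpace {c : ℂ | c ≠ 0} := hopen.locallyCompactSpace
  have : SigmaCompactSpace {c : ℂ | c ≠ 0} :=
    sigmaCompactSpace_of_locallyCompact_secondCountable
  let P : (Fin m → A) × (Fin (N - m) → ℂ) × {c : ℂ | c ≠ 0} → ℂ[X] := fun t =>
    C (t.2.2 : ℂ) * ((∏ i, (X - C (t.1 i : ℂ))) * ∏ i, (X - C (t.2.1 i)))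
  have hcont : Continuous fun t => fun k : Fin (N + 1) => (P t).coeff k := by
    refine continuous_pi fun k => continuous_coeff_mul (fun j => ?_)
      (continuous_coeff_mul (continuous_coeff_prod _ fun i j => continuous_coeff_X_sub_C
          (by fun_prop) j)
        (continuous_coeff_prod _ fun i j => continuous_coeff_X_sub_C (by fun_prop) j)) k
    simp only [coeff_C]
    split_ifs <;> fun_prop
  convert isSigmaCompact_range hcont using 1
  have hroots (t) : (P t).roots = (Finset.univ : Finset (Fin m)).val.map (fun i => (t.1 i : ℂ)) +
      (Finset.univ : Finset (Fin (N - m))).val.map t.2.1 := by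
    have hmon1 : (∏ i, (X - C (t.1 i : ℂ))).Monic := monic_prod_X_sub_C _ _
    have hmon2 : (∏ i, (X - C (t.2.1 i))).Monic := monic_prod_X_sub_C _ _
    simp only [P]
    rw [roots_C_mul _ t.2.2.2, roots_mul (hmon1.mul hmon2).ne_zero]
    congr 1
    · rw [← roots_multiset_prod_X_sub_C (Multiset.map (fun i => (t.1 i : ℂ)) _), Multiset.map_map]
      rfl
    · rw [← roots_multiset_prod_X_sub_C (Multiset.map t.2.1 _), Multiset.map_map]
      rfl
  have hdeg (t) : (P t).natDegree = N := by
    rw [(IsAlgClosed.splits (P t)).natDegree_eq_card_roots, hroots]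
    simp [hm]
  have hlead (t) : (P t).leadingCoeff = t.2.2 := by
    simp only [P]
    rw [leadingCoeff_mul, leadingCoeff_C,
      ((monic_prod_X_sub_C _ _).mul (monic_prod_X_sub_C _ _)).leadingCoeff, mul_one]
  ext b
  constructor
  · rintro ⟨hb, hcount⟩
    have hN : extendZero N b N ≠ 0 := by simpa [extendZero, Fin.last] using hb
    set R := (poly N (extendZero N b)).roots with hR
    rw [Multiset.countP_eq_card_filter] at hcount
    obtain ⟨s, hs, hsm⟩ : ∃ s ≤ R.filter (· ∈ A), s.card = m := by
      refine ⟨((R.filter (· ∈ A)).toList.take m : List ℂ), ?_, ?_⟩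
      · conv_rhs => rw [← Multiset.coe_toList (R.filter (· ∈ A))]
        exact Multiset.coe_le.2 (List.take_sublist _ _).subperm
      · simpa using hcount
    obtain ⟨u, hu⟩ := Multiset.le_iff_exists_add.1 (hs.trans (Multiset.filter_le _ _))
    have hcard := card_roots_poly hN
    rw [← hR, hu, Multiset.card_add, hsm] at hcard
    obtain ⟨x, hx⟩ := exists_fin_map_eq hsm
    obtain ⟨y, hy⟩ := exists_fin_map_eq (show u.card = N - m by omega)
    have hxA (i : Fin m) : x i ∈ A := by
      have : x i ∈ s := hx ▸ Multiset.mem_map_of_mem x (Finset.mem_univ i)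
      exact (Multiset.mem_filter.1 (Multiset.mem_of_le hs this)).2
    let t : (Fin m → A) × (Fin (N - m) → ℂ) × {c : ℂ | c ≠ 0} :=
      (fun i => ⟨x i, hxA i⟩, y, ⟨b (Fin.last N), hb⟩)
    refine ⟨t, ?_⟩
    have hPt : P t = poly N (extendZero N b) := by
      rw [(IsAlgClosed.splits (P t)).eq_prod_roots,
        (IsAlgClosed.splits (poly N (extendZero N b))).eq_prod_roots, hroots, hlead,
        leadingCoeff_poly hN, ← hR, hu]
      simp only [t, hx, hy]
      simp [extendZero, Fin.last]
    funext k
    simp only [hPt]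
    rw [coeff_poly, if_pos (Nat.lt_succ_iff.1 k.2), extendZero, dif_pos k.2]
  · rintro ⟨t, rfl⟩
    have hP : poly N (extendZero N fun k => (P t).coeff k) = P t := by
      ext k
      rw [coeff_poly]
      split_ifs with hk
      · rw [extendZero, dif_pos (Nat.lt_succ_iff.2 hk)]
      · rw [coeff_eq_zero_of_natDegree_lt (by rw [hdeg]; omega)]
    refine ⟨?_, ?_⟩
    · have h1 : (P t).coeff N = t.2.2 := by
        rw [← hlead t, leadingCoeff, hdeg]
      change (P t).coeff N ≠ 0
      rw [h1]
      exact t.2.2.2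
    · rw [hP, hroots, Multiset.countP_add]
      refine le_add_right (le_of_eq ?_)
      rw [Multiset.countP_eq_card.2]
      · simp
      · intro z hz
        obtain ⟨i, _, rfl⟩ := Multiset.mem_map.1 hz
        exact (t.1 i).2

lemma measurableSet_of_isSigmaCompact {α : Type*} [TopologicalSpace α] [T2Space α]
    [MeasurableSpace α] [OpensMeasurableSpace α] {s : Set α} (hs : IsSigmaCompact s) :
    MeasurableSet s := by
  obtain ⟨K, hK, rfl⟩ := hs
  exact MeasurableSet.iUnion fun n => (hK n).measurableSet

/-- The value `0` on the coefficient vectors of degree less than `N` confines the claim to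
polynomials of exact degree `N`, whose zeros parametrize them. -/
lemma measurable_countP_roots {A : Set ℂ} (hA : IsSigmaCompact A) [DecidablePred (· ∈ A)] (N : ℕ) :
    Measurable fun b : Fin (N + 1) → ℂ => if b (Fin.last N) = 0 then 0 else
      (poly N (extendZero N b)).roots.countP (· ∈ A) := by
  refine measurable_of_Ici fun m => ?_
  rcases Nat.eq_zero_or_pos m with rfl | hm0
  · simp
  rcases le_or_gt m N with hm | hm
  · convert measurableSet_of_isSigmaCompact (isSigmaCompact_setOf_le_countP hA hm) using 1
    ext b
    by_cases hb : b (Fin.last N) = 0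
    · simp [hb, hm0.ne']
    · simp [hb]
  · convert! MeasurableSet.empty
    ext b
    have h1 := (Multiset.countP_le_card (· ∈ A) (poly N (extendZero N b)).roots).trans
      (card_roots_poly_le N (extendZero N b))
    simp only [Set.mem_preimage, Set.mem_Ici, Set.mem_empty_iff_false, iff_false, not_le]
    split_ifs <;> omega

lemma aemeasurable_countP_roots {Ω : Type*} [MeasurableSpace Ω] {μ : Measure Ω} {A : Set ℂ}
    (hA : IsSigmaCompact A) [DecidablePred (· ∈ A)] {N : ℕ} {a : ℕ → Ω → ℂ}
    (ha : ∀ k ≤ N, Measurable (a k)) (haN : ∀ᵐ ω ∂μ, a N ω ≠ 0) :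
    AEMeasurable (fun ω => (poly N fun k => a k ω).roots.countP (· ∈ A)) μ := by
  have hmeas : Measurable fun ω => fun k : Fin (N + 1) => a k ω :=
    measurable_pi_lambda _ fun k => ha k (Nat.lt_succ_iff.1 k.2)
  refine ⟨_, (measurable_countP_roots hA N).comp hmeas, ?_⟩
  filter_upwards [haN] with ω hω
  have hpoly : poly N (extendZero N fun k : Fin (N + 1) => a k ω) = poly N fun k => a k ω := by
    ext k
    rw [coeff_poly, coeff_poly]
    split_ifs with hk
    · rw [extendZero, dif_pos (Nat.lt_succ_iff.2 hk)]
    · rfl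
  simp [hω, hpoly]

lemma argTwoPi_exp {s t : ℝ} (ht : t ∈ Set.Ico 0 (2 * Real.pi)) :
    argTwoPi (Complex.exp (s + t * Complex.I)) = t := by
  have h1 := argTwoPi_mem_Ico (Complex.exp (s + t * Complex.I))
  rw [← zero_add (2 * Real.pi)] at h1 ht
  refine (AddCircle.coe_eq_coe_iff_of_mem_Ico h1 ht).1 ?_
  rw [coe_argTwoPi]
  rw [Complex.exp_add, Complex.exp_mul_I, ← Complex.ofReal_exp]
  have h := Complex.arg_mul_cos_add_sin_mul_I_coe_angle (Real.exp_pos s) (t : Real.Angle)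
  rwa [Real.Angle.cos_coe, Real.Angle.sin_coe, Complex.ofReal_cos, Complex.ofReal_sin] at h

lemma isSigmaCompact_annulus (ρ : ℝ) :
    IsSigmaCompact {z : ℂ | 1 - ρ ≤ ‖z‖ ∧ (ρ < 1 → ‖z‖ ≤ 1 / (1 - ρ))} := by
  refine isSigmaCompact_univ.of_isClosed_subset ?_ (Set.subset_univ _)
  by_cases h : ρ < 1
  · simpa only [h, true_implies] using
      (isClosed_le continuous_const continuous_norm).and (isClosed_le continuous_norm
        continuous_const)
  · simpa only [h, false_implies, and_true] using isClosed_le continuous_const continuous_norm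

/-- Away from the origin the sector is the image of `ℝ × [θ, φ)` under `(s, t) ↦ exp (s + i t)`. -/
lemma isSigmaCompact_sector {θ φ : ℝ} (h0 : 0 ≤ θ) (h1 : φ ≤ 2 * Real.pi) :
    IsSigmaCompact {z : ℂ | θ ≤ argTwoPi z ∧ argTwoPi z < φ} := by
  set S := {z : ℂ | θ ≤ argTwoPi z ∧ argTwoPi z < φ}
  have : LocallyCompactSpace (Set.Ico θ φ) :=
    (isClosed_Ici.isLocallyClosed.inter isOpen_Iio.isLocallyClosed).locallyCompactSpace
  have : SigmaCompactSpace (Set.Ico θ φ) := sigmaCompactSpace_of_locallyCompact_secondCountable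
  have hrange : IsSigmaCompact (Set.range fun p : ℝ × Set.Ico θ φ =>
      Complex.exp (p.1 + (p.2 : ℝ) * Complex.I)) :=
    isSigmaCompact_range (by fun_prop)
  have hzero : IsSigmaCompact (S ∩ {0}) :=
    ((Set.finite_singleton 0).subset Set.inter_subset_right).isCompact.isSigmaCompact
  have hS : S = ⋃ b : Bool, bif b then S ∩ {0} else
      Set.range fun p : ℝ × Set.Ico θ φ => Complex.exp (p.1 + (p.2 : ℝ) * Complex.I) := by
    rw [← Set.union_eq_iUnion]
    ext z
    constructor
    · intro hz
      by_cases hz0 : z = 0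
      · exact Or.inl ⟨hz, hz0⟩
      · refine Or.inr ⟨(Real.log ‖z‖, ⟨argTwoPi z, hz⟩), ?_⟩
        have h := fourier_coe_argTwoPi hz0 1
        have hz' : (‖z‖ : ℂ) ≠ 0 := by simpa using hz0
        have hpi : 2 * (Real.pi : ℂ) * Complex.I * ((1 : ℕ) : ℤ) * argTwoPi z /
            ((2 * Real.pi : ℝ) : ℂ) = argTwoPi z * Complex.I := by
          have : (Real.pi : ℂ) ≠ 0 := by exact_mod_cast Real.pi_ne_zero
          push_cast
          field_simp
        rw [fourier_coe_apply, pow_one, hpi, eq_div_iff hz'] at h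
        simp only
        rw [Complex.exp_add, ← Complex.ofReal_exp, Real.exp_log (norm_pos_iff.2 hz0), mul_comm, h]
    · rintro (hz | ⟨⟨s, t, ht⟩, rfl⟩)
      · exact hz.1
      · have h := argTwoPi_exp (s := s) ⟨h0.trans ht.1, ht.2.trans_le h1⟩
        exact ⟨ht.1.trans h.ge, h.le.trans_lt ht.2⟩
  rw [hS]
  exact isSigmaCompact_iUnion _ fun b => by cases b <;> assumption

section Random
variable {Ω : Type*} [MeasurableSpace Ω] {μ : Measure Ω} {N : ℕ} {a : ℕ → Ω → ℂ}

lemma aestronglyMeasurable_annulusFraction (ha : ∀ k ≤ N, Measurable (a k))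
    (haN : ∀ᵐ ω ∂μ, a N ω ≠ 0) (ρ : ℝ) :
    AEStronglyMeasurable (fun ω => annulusFraction N (fun k => a k ω) ρ) μ := by
  classical
  have h := aemeasurable_countP_roots (isSigmaCompact_annulus ρ) ha haN
  have h2 : AEMeasurable (fun ω => annulusCount (poly N fun k => a k ω) ρ) μ := by
    unfold annulusCount
    convert! h
  exact ((measurable_from_nat (f := fun n : ℕ => (n : ℝ) / N)).comp_aemeasurable
    h2).aestronglyMeasurable

lemma aestronglyMeasurable_sectorFraction (ha : ∀ k ≤ N, Measurable (a k))
    (haN : ∀ᵐ ω ∂μ, a N ω ≠ 0) {θ φ : ℝ} (h0 : 0 ≤ θ) (h1 : φ ≤ 2 * Real.pi) :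
    AEStronglyMeasurable (fun ω => sectorFraction N (fun k => a k ω) θ φ) μ := by
  classical
  have h := aemeasurable_countP_roots (isSigmaCompact_sector h0 h1) ha haN
  have h2 : AEMeasurable (fun ω => sectorCount (poly N fun k => a k ω) θ φ) μ := by
    unfold sectorCount
    convert! h
  exact ((measurable_from_nat (f := fun n : ℕ => (n : ℝ) / N)).comp_aemeasurable
    h2).aestronglyMeasurable

end Random

lemma countP_roots_div_mem_Icc (N : ℕ) (a : ℕ → ℂ) (A : ℂ → Prop) [DecidablePred A] :
    ((poly N a).roots.countP A : ℝ) / N ∈ Set.Icc (0 : ℝ) 1 := by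
  refine ⟨by positivity, div_le_one_of_le₀ ?_ (by positivity)⟩
  exact_mod_cast (Multiset.countP_le_card A _).trans (card_roots_poly_le N a)

lemma annulusFraction_mem_Icc (N : ℕ) (a : ℕ → ℂ) (ρ : ℝ) :
    annulusFraction N a ρ ∈ Set.Icc (0 : ℝ) 1 := by
  classical exact countP_roots_div_mem_Icc N a _

lemma sectorFraction_mem_Icc (N : ℕ) (a : ℕ → ℂ) (θ φ : ℝ) :
    sectorFraction N a θ φ ∈ Set.Icc (0 : ℝ) 1 := by
  classical exact countP_roots_div_mem_Icc N a _

end ZeroClustering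

/-! ### From deterministic bounds to random polynomials -/

namespace ZeroClustering

section Convergence
variable {Ω : Type*} [MeasurableSpace Ω] {μ : Measure Ω} [IsProbabilityMeasure μ]

lemma tendsto_eLpNorm_of_tendstoInMeasure {X : ℕ → Ω → ℝ} {c : ℝ}
    (hX : ∀ N, AEStronglyMeasurable (X N) μ) (hb : ∀ N ω, X N ω ∈ Set.Icc (0 : ℝ) 1)
    (h : TendstoInMeasure μ X atTop fun _ => c) {p : ENNReal} (hp : 1 ≤ p) (hp' : p ≠ ⊤) :
    Tendsto (fun N => eLpNorm (fun ω => X N ω - c) p μ) atTop (𝓝 0) := by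
  refine tendsto_Lp_finite_of_tendstoInMeasure hp hp' hX (memLp_const c) ?_ h
  -- variables bounded by `1` never exceed the truncation level `2`
  refine unifIntegrable_of hp hp' hX fun ε _ => ⟨2, fun N => ?_⟩
  have : {x | (2 : NNReal) ≤ ‖X N x‖₊} = ∅ := by
    ext ω
    have := hb N ω
    have h2 : ‖X N ω‖ < 2 := by
      rw [Real.norm_of_nonneg this.1]
      linarith [this.2]
    simpa [← NNReal.coe_lt_coe] using h2
  simp [this]

/-- For variables with values in `[0, 1]`, convergence in measure to a constant implies convergence
in every mean. -/
lemma tendstoInMean_of_tendstoInMeasure {X : ℕ → Ω → ℝ} {c : ℝ}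
    (hX : ∀ N, AEStronglyMeasurable (X N) μ) (hb : ∀ N ω, X N ω ∈ Set.Icc (0 : ℝ) 1)
    (h : TendstoInMeasure μ X atTop fun _ => c) (p : ℝ) : TendstoInMean μ X c p := by
  refine tendsto_of_tendsto_of_tendsto_of_le_of_le tendsto_const_nhds
    (tendsto_eLpNorm_of_tendstoInMeasure hX hb h (p := max 1 (ENNReal.ofReal p))
      (le_max_left _ _) (max_lt ENNReal.one_lt_top ENNReal.ofReal_lt_top).ne)
    (fun _ => zero_le) fun N => ?_
  exact eLpNorm_le_eLpNorm_of_exponent_le (le_max_right _ _)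
    ((hX N).sub aestronglyMeasurable_const)

lemma tendsto_integral_of_tendstoInMeasure {X : ℕ → Ω → ℝ} {c : ℝ}
    (hX : ∀ N, AEStronglyMeasurable (X N) μ) (hb : ∀ N ω, X N ω ∈ Set.Icc (0 : ℝ) 1)
    (h : TendstoInMeasure μ X atTop fun _ => c) :
    Tendsto (fun N => ∫ ω, X N ω ∂μ) atTop (𝓝 c) := by
  have := tendsto_integral_of_L1' (μ := μ) (fun _ => c) aestronglyMeasurable_const
    (F := X) (l := atTop) (Eventually.of_forall fun N => Integrable.of_bound (hX N) 1
      (ae_of_all _ fun ω => by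
        rw [Real.norm_of_nonneg (hb N ω).1]
        exact (hb N ω).2))
    (tendsto_eLpNorm_of_tendstoInMeasure hX hb h le_rfl ENNReal.one_ne_top)
  simpa using this

/-- If `X N` is close to `c` wherever `L N` is small compared with `β N`, and the expectation of
`L N ≥ 0` is `o(β N)`, then `X N` tends to `c` in measure, by Markov's inequality. -/
lemma tendstoInMeasure_of_tendsto_integral_div {X L : ℕ → Ω → ℝ} {β : ℕ → ℝ} {c : ℝ}
    (hβ : ∀ᶠ N in atTop, 0 < β N) (hL : ∀ᶠ N in atTop, Integrable (L N) μ)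
    (hL0 : ∀ᶠ N in atTop, 0 ≤ᵐ[μ] L N)
    (hlim : Tendsto (fun N => (∫ ω, L N ω ∂μ) / β N) atTop (𝓝 0))
    (hX : ∀ ε > 0, ∃ δ > 0, ∀ᶠ N in atTop, ∀ᵐ ω ∂μ, L N ω < δ * β N → |X N ω - c| < ε) :
    TendstoInMeasure μ X atTop fun _ => c := by
  rw [tendstoInMeasure_iff_measureReal_dist]
  intro ε hε
  obtain ⟨δ, hδ, hXδ⟩ := hX ε hε
  have hlim' : Tendsto (fun N => (∫ ω, L N ω ∂μ) / β N / δ) atTop (𝓝 0) := by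
    simpa using hlim.div_const δ
  refine squeeze_zero' (Eventually.of_forall fun N => measureReal_nonneg) ?_ hlim'
  filter_upwards [hβ, hL, hL0, hXδ] with N hβN hLN hL0N hXN
  have h1 := mul_meas_ge_le_integral_of_nonneg hL0N hLN (δ * β N)
  have h2 : μ.real {ω | ε ≤ dist (X N ω) c} ≤ μ.real {ω | δ * β N ≤ L N ω} := by
    refine ENNReal.toReal_mono (measure_ne_top _ _) (measure_mono_ae ?_)
    filter_upwards [hXN] with ω hω hεω
    by_contra hlt
    exact absurd (hω (not_le.1 hlt)) (not_lt.2 hεω)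
  refine h2.trans ?_
  rw [div_div, le_div_iff₀ (by positivity)]
  linarith

end Convergence

lemma abs_annulusFraction_sub_one_le {N : ℕ} (hN1 : 1 ≤ N) {a : ℕ → ℂ} (h0 : a 0 ≠ 0)
    (hN : a N ≠ 0) {α : ℝ} (hα : 0 < α) :
    |annulusFraction N a (α / N) - 1| ≤ 2 * (logSize N a / α) := by
  have hN' : (0 : ℝ) < N := by exact_mod_cast hN1
  have h := mul_sub_annulusCount_le h0 hN (α / N)
  rw [abs_sub_comm, abs_of_nonneg (sub_nonneg.2 (annulusFraction_mem_Icc N a _).2), ← mul_div_assoc,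
    le_div_iff₀ hα]
  refine le_trans (le_of_eq ?_) h
  rw [annulusFraction]
  field_simp

/-- A sequence `α = o(N)`, positive and at most `N`, which dominates `N e N` for a given null
sequence `e`. -/
lemma exists_rate {e : ℕ → ℝ} (he : Tendsto e atTop (𝓝 0)) :
    ∃ α : ℕ → ℝ, (∀ N : ℕ, 1 ≤ N → 0 < α N ∧ α N ≤ N) ∧
      α =o[atTop] (fun N : ℕ => (N : ℝ)) ∧
      Tendsto (fun N : ℕ => N * e N / α N) atTop (𝓝 0) := by
  -- the rate `N √|e N|` would do, except where `e` vanishes or exceeds `1`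
  set r : ℕ → ℝ := fun N => min 1 (√|e N| + 1 / ((N : ℝ) + 1)) with hr
  have hr0 (N : ℕ) : 0 < r N := lt_min one_pos (by positivity)
  have habs : Tendsto (fun N => |e N|) atTop (𝓝 0) := by simpa using he.abs
  have hsqrt : Tendsto (fun N => √|e N|) atTop (𝓝 0) := by
    simpa [Function.comp_def] using (Real.continuous_sqrt.tendsto 0).comp habs
  have hrlim : Tendsto r atTop (𝓝 0) := by
    have := hsqrt.add (tendsto_one_div_add_atTop_nhds_zero_nat (𝕜 := ℝ))
    rw [add_zero] at this
    exact squeeze_zero (fun N => (hr0 N).le) (fun N => min_le_right _ _) this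
  refine ⟨fun N => N * r N, fun N hN => ⟨?_, ?_⟩, ?_, ?_⟩
  · have := hr0 N
    positivity
  · exact mul_le_of_le_one_right (by positivity) (min_le_left _ _)
  · have := (Asymptotics.isBigO_refl (fun N : ℕ => (N : ℝ)) atTop).mul_isLittleO
      ((Asymptotics.isLittleO_one_iff ℝ).2 hrlim)
    simpa using this
  · refine squeeze_zero_norm' ?_ (show Tendsto (fun N => |e N| + √|e N|) atTop (𝓝 0) by
      simpa using habs.add hsqrt)
    filter_upwards [eventually_ge_atTop 1] with N hN
    have hN' : (N : ℝ) ≠ 0 := by positivity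
    rw [mul_div_mul_left _ _ hN', norm_div, Real.norm_eq_abs, Real.norm_of_nonneg (hr0 N).le,
      div_le_iff₀ (hr0 N)]
    have hs := Real.sqrt_nonneg |e N|
    have hsq := Real.mul_self_sqrt (abs_nonneg (e N))
    rcases min_choice 1 (√|e N| + 1 / ((N : ℝ) + 1)) with h | h
    · rw [hr]; simp only; rw [h]; linarith
    · rw [hr]; simp only; rw [h]
      have h3 : 0 ≤ 1 / ((N : ℝ) + 1) := by positivity
      nlinarith [mul_nonneg hs h3, mul_nonneg (abs_nonneg (e N)) (add_nonneg hs h3)]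

lemma tendsto_sectorFraction_atTop {θ φ : ℝ} (h0 : 0 ≤ θ) (h1 : θ ≤ φ) (h2 : φ ≤ 2 * Real.pi)
    {b : ℕ → ℕ → ℂ} (hb : ∀ N : ℕ, 1 ≤ N → b N 0 ≠ 0 ∧ b N N ≠ 0)
    (hL : Tendsto (fun N : ℕ => logSize N (b N) / N) atTop (𝓝 0)) :
    Tendsto (fun N => sectorFraction N (b N) θ φ) atTop (𝓝 ((φ - θ) / (2 * Real.pi))) := by
  have hsmall : Tendsto (fun N : ℕ => (N, b N)) atTop smallSize := by
    rw [smallSize, tendsto_inf, tendsto_comap_iff, tendsto_principal]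
    refine ⟨by simpa only [Function.comp_def] using hL, ?_⟩
    filter_upwards [eventually_ge_atTop 1] with N hN using ⟨hN, hb N hN⟩
  have h := (tendsto_sectorFraction h0 h1 h2).comp hsmall
  simpa only [Function.comp_def] using h

/-- The convergence of the fraction of zeros in a sector along `smallSize`, with explicit
thresholds. -/
lemma exists_abs_sectorFraction_sub_lt {θ φ ε : ℝ} (h0 : 0 ≤ θ) (h1 : θ ≤ φ)
    (h2 : φ ≤ 2 * Real.pi) (hε : 0 < ε) :
    ∃ δ > 0, ∀ (N : ℕ) (a : ℕ → ℂ), 1 ≤ N → a 0 ≠ 0 → a N ≠ 0 → logSize N a < δ * N →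
      |sectorFraction N a θ φ - (φ - θ) / (2 * Real.pi)| < ε := by
  have h := Metric.tendsto_nhds.1 (tendsto_sectorFraction h0 h1 h2) ε hε
  rw [smallSize, eventually_inf_principal, eventually_comap] at h
  obtain ⟨δ, hδ, hball⟩ := Metric.eventually_nhds_iff.1 h
  refine ⟨δ, hδ, fun N a hN1 ha0 haN hL => ?_⟩
  have hN' : (0 : ℝ) < N := by exact_mod_cast hN1
  refine hball (y := logSize N a / N) ?_ (N, a) rfl ⟨hN1, ha0, haN⟩
  rw [Real.dist_eq, sub_zero, abs_of_nonneg (div_nonneg (logSize_nonneg ha0 haN) hN'.le),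
    div_lt_iff₀ hN']
  exact hL

end ZeroClustering

theorem mainTheorem3 {Ω : Type*} [MeasurableSpace Ω] (μ : Measure Ω) [IsProbabilityMeasure μ]
    (a : ℕ → ℕ → Ω → ℂ)
    (ha : ∀ N k : ℕ, 1 ≤ N → k ≤ N → Measurable (a N k))
    (ha0 : ∀ N : ℕ, 1 ≤ N → μ {ω | a N 0 ω = 0} = 0)
    (haN : ∀ N : ℕ, 1 ≤ N → μ {ω | a N N ω = 0} = 0) :
    -- the zero counts have honest expectations
    (∀ N : ℕ, 1 ≤ N →
      (∀ ρ : ℝ, 0 ≤ ρ → ρ ≤ 1 →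
        Integrable (fun ω => ZeroClustering.annulusFraction N (fun k => a N k ω) ρ) μ) ∧
      (∀ θ φ : ℝ, 0 ≤ θ → θ < φ → φ ≤ 2 * Real.pi →
        Integrable (fun ω => ZeroClustering.sectorFraction N (fun k => a N k ω) θ φ) μ)) ∧
    -- convergence in expectation, in probability and in `p`-th mean
    ((∀ᶠ N : ℕ in atTop,
        Integrable (fun ω => ZeroClustering.logSize N (fun k => a N k ω)) μ) →
      (fun N : ℕ => ∫ ω, ZeroClustering.logSize N (fun k => a N k ω) ∂μ)
        =o[atTop] (fun N : ℕ => (N : ℝ)) →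
      (∃ α : ℕ → ℝ,
        (∀ N : ℕ, 1 ≤ N → 0 < α N ∧ α N ≤ N) ∧
        α =o[atTop] (fun N : ℕ => (N : ℝ)) ∧
        Tendsto (fun N : ℕ =>
          ∫ ω, ZeroClustering.annulusFraction N (fun k => a N k ω) (α N / N) ∂μ)
          atTop (𝓝 1) ∧
        TendstoInMeasure μ (fun (N : ℕ) ω =>
          ZeroClustering.annulusFraction N (fun k => a N k ω) (α N / N))
          atTop (fun _ => (1 : ℝ)) ∧
        ∀ p : ℝ, 0 < p → ZeroClustering.TendstoInMean μ (fun N ω =>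
          ZeroClustering.annulusFraction N (fun k => a N k ω) (α N / N)) 1 p) ∧
      (∀ θ φ : ℝ, 0 ≤ θ → θ < φ → φ ≤ 2 * Real.pi →
        Tendsto (fun N : ℕ =>
          ∫ ω, ZeroClustering.sectorFraction N (fun k => a N k ω) θ φ ∂μ)
          atTop (𝓝 ((φ - θ) / (2 * Real.pi))) ∧
        TendstoInMeasure μ (fun (N : ℕ) ω =>
          ZeroClustering.sectorFraction N (fun k => a N k ω) θ φ)
          atTop (fun _ => (φ - θ) / (2 * Real.pi)) ∧
        ∀ p : ℝ, 0 < p → ZeroClustering.TendstoInMean μ (fun N ω =>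
          ZeroClustering.sectorFraction N (fun k => a N k ω) θ φ)
          ((φ - θ) / (2 * Real.pi)) p)) ∧
    -- almost sure convergence
    (∀ α : ℕ → ℝ,
      (∀ N : ℕ, 1 ≤ N → 0 < α N ∧ α N ≤ N) →
      (∀ᵐ ω ∂μ, (fun N : ℕ => ZeroClustering.logSize N (fun k => a N k ω)) =o[atTop] α) →
      ((∀ᵐ ω ∂μ, Tendsto (fun N : ℕ =>
          ZeroClustering.annulusFraction N (fun k => a N k ω) (α N / N)) atTop (𝓝 1)) ∧
        ∀ p : ℝ, 0 < p → ZeroClustering.TendstoInMean μ (fun N ω =>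
          ZeroClustering.annulusFraction N (fun k => a N k ω) (α N / N)) 1 p) ∧
      (∀ θ φ : ℝ, 0 ≤ θ → θ < φ → φ ≤ 2 * Real.pi →
        (∀ᵐ ω ∂μ, Tendsto (fun N : ℕ =>
          ZeroClustering.sectorFraction N (fun k => a N k ω) θ φ)
          atTop (𝓝 ((φ - θ) / (2 * Real.pi)))) ∧
        ∀ p : ℝ, 0 < p → ZeroClustering.TendstoInMean μ (fun N ω =>
          ZeroClustering.sectorFraction N (fun k => a N k ω) θ φ)
          ((φ - θ) / (2 * Real.pi)) p)) := by
  have hne : ∀ N : ℕ, 1 ≤ N → ∀ᵐ ω ∂μ, a N 0 ω ≠ 0 ∧ a N N ω ≠ 0 := fun N hN =>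
    (ae_iff.2 (by simpa using ha0 N hN)).and (ae_iff.2 (by simpa using haN N hN))
  have hmeasA : ∀ (N : ℕ) (ρ : ℝ), AEStronglyMeasurable
      (fun ω => ZeroClustering.annulusFraction N (fun k => a N k ω) ρ) μ := by
    intro N ρ
    rcases Nat.eq_zero_or_pos N with rfl | hN
    · -- at `N = 0` the fraction is `_ / 0 = 0`
      simpa [ZeroClustering.annulusFraction] using aestronglyMeasurable_const
    · exact ZeroClustering.aestronglyMeasurable_annulusFraction (fun k hk => ha N k hN hk)
        ((hne N hN).mono fun ω h => h.2) ρ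
  have hmeasS : ∀ (N : ℕ) (θ φ : ℝ), 0 ≤ θ → φ ≤ 2 * Real.pi → AEStronglyMeasurable
      (fun ω => ZeroClustering.sectorFraction N (fun k => a N k ω) θ φ) μ := by
    intro N θ φ h0 h1
    rcases Nat.eq_zero_or_pos N with rfl | hN
    · simpa [ZeroClustering.sectorFraction] using aestronglyMeasurable_const
    · exact ZeroClustering.aestronglyMeasurable_sectorFraction (fun k hk => ha N k hN hk)
        ((hne N hN).mono fun ω h => h.2) h0 h1
  have hbA := fun (ρ : ℕ → ℝ) (N : ℕ) (ω : Ω) =>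
    ZeroClustering.annulusFraction_mem_Icc N (fun k => a N k ω) (ρ N)
  have hbS := fun (θ φ : ℝ) (N : ℕ) (ω : Ω) =>
    ZeroClustering.sectorFraction_mem_Icc N (fun k => a N k ω) θ φ
  refine ⟨fun N _ => ⟨fun ρ _ _ => ?_, fun θ φ h0 _ h2 => ?_⟩, fun hint hE => ⟨?_, ?_⟩,
    fun α hα hL => ⟨?_, ?_⟩⟩
  · refine Integrable.of_bound (hmeasA N ρ) 1 (ae_of_all _ fun ω => ?_)
    rw [Real.norm_of_nonneg (hbA (fun _ => ρ) N ω).1]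
    exact (hbA (fun _ => ρ) N ω).2
  · refine Integrable.of_bound (hmeasS N θ φ h0 h2) 1 (ae_of_all _ fun ω => ?_)
    rw [Real.norm_of_nonneg (hbS θ φ N ω).1]
    exact (hbS θ φ N ω).2
  · have he := hE.tendsto_div_nhds_zero
    obtain ⟨α, hα, hαo, hlim⟩ := ZeroClustering.exists_rate he
    have hconv : TendstoInMeasure μ (fun (N : ℕ) ω =>
        ZeroClustering.annulusFraction N (fun k => a N k ω) (α N / N)) atTop fun _ => (1 : ℝ) := by
      refine ZeroClustering.tendstoInMeasure_of_tendsto_integral_div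
        (L := fun N ω => ZeroClustering.logSize N (fun k => a N k ω)) (β := α) ?_ hint ?_ ?_ ?_
      · filter_upwards [eventually_ge_atTop 1] with N hN using (hα N hN).1
      · filter_upwards [eventually_ge_atTop 1] with N hN
        filter_upwards [hne N hN] with ω hω using ZeroClustering.logSize_nonneg hω.1 hω.2
      · refine hlim.congr' ?_
        filter_upwards [eventually_ge_atTop 1] with N hN
        have hN' : (N : ℝ) ≠ 0 := by positivity
        rw [mul_div_cancel₀ _ hN']
      · refine fun ε hε => ⟨ε / 2, half_pos hε, ?_⟩
        filter_upwards [eventually_ge_atTop 1] with N hN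
        filter_upwards [hne N hN] with ω hω hlt
        refine (ZeroClustering.abs_annulusFraction_sub_one_le hN hω.1 hω.2 (hα N hN).1).trans_lt ?_
        rw [← div_lt_iff₀ (hα N hN).1] at hlt
        linarith
    exact ⟨α, hα, hαo, ZeroClustering.tendsto_integral_of_tendstoInMeasure
      (fun N => hmeasA N _) (hbA _) hconv, hconv, fun p _ =>
        ZeroClustering.tendstoInMean_of_tendstoInMeasure (fun N => hmeasA N _) (hbA _) hconv p⟩
  · intro θ φ h0 h1 h2
    have hconv : TendstoInMeasure μ (fun (N : ℕ) ω =>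
        ZeroClustering.sectorFraction N (fun k => a N k ω) θ φ) atTop
        fun _ => (φ - θ) / (2 * Real.pi) := by
      refine ZeroClustering.tendstoInMeasure_of_tendsto_integral_div
        (L := fun N ω => ZeroClustering.logSize N (fun k => a N k ω)) (β := fun N => (N : ℝ))
        ?_ hint ?_ hE.tendsto_div_nhds_zero fun ε hε => ?_
      · filter_upwards [eventually_ge_atTop 1] with N hN
        exact_mod_cast hN
      · filter_upwards [eventually_ge_atTop 1] with N hN
        filter_upwards [hne N hN] with ω hω using ZeroClustering.logSize_nonneg hω.1 hω.2
      · obtain ⟨δ, hδ, h⟩ := ZeroClustering.exists_abs_sectorFraction_sub_lt h0 h1.le h2 hε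
        refine ⟨δ, hδ, ?_⟩
        filter_upwards [eventually_ge_atTop 1] with N hN
        filter_upwards [hne N hN] with ω hω hlt using h N _ hN hω.1 hω.2 hlt
    exact ⟨ZeroClustering.tendsto_integral_of_tendstoInMeasure
      (fun N => hmeasS N _ _ h0 h2) (hbS θ φ) hconv, hconv, fun p _ =>
        ZeroClustering.tendstoInMean_of_tendstoInMeasure (fun N => hmeasS N _ _ h0 h2)
          (hbS θ φ) hconv p⟩
  · have hne' : ∀ᵐ ω ∂μ, ∀ N : ℕ, 1 ≤ N → a N 0 ω ≠ 0 ∧ a N N ω ≠ 0 :=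
      ae_all_iff.2 fun N => ae_all_iff.2 fun hN => hne N hN
    have hae : ∀ᵐ ω ∂μ, Tendsto (fun N : ℕ =>
        ZeroClustering.annulusFraction N (fun k => a N k ω) (α N / N)) atTop (𝓝 1) := by
      filter_upwards [hne', hL] with ω hω hLω
      rw [tendsto_iff_norm_sub_tendsto_zero]
      refine squeeze_zero' (Eventually.of_forall fun N => norm_nonneg _) ?_
        (show Tendsto (fun N => 2 * (ZeroClustering.logSize N (fun k => a N k ω) / α N)) atTop
          (𝓝 0) by simpa using hLω.tendsto_div_nhds_zero.const_mul 2)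
      filter_upwards [eventually_ge_atTop 1] with N hN
      exact ZeroClustering.abs_annulusFraction_sub_one_le hN (hω N hN).1 (hω N hN).2 (hα N hN).1
    exact ⟨hae, fun p _ => ZeroClustering.tendstoInMean_of_tendstoInMeasure
      (fun N => hmeasA N _) (hbA _) (tendstoInMeasure_of_tendsto_ae (fun N => hmeasA N _) hae) p⟩
  · intro θ φ h0 h1 h2
    have hne' : ∀ᵐ ω ∂μ, ∀ N : ℕ, 1 ≤ N → a N 0 ω ≠ 0 ∧ a N N ω ≠ 0 :=
      ae_all_iff.2 fun N => ae_all_iff.2 fun hN => hne N hN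
    have hαO : α =O[atTop] (fun N : ℕ => (N : ℝ)) := by
      refine Asymptotics.IsBigO.of_bound 1 ?_
      filter_upwards [eventually_ge_atTop 1] with N hN
      rw [one_mul, Real.norm_of_nonneg (hα N hN).1.le, Real.norm_natCast]
      exact (hα N hN).2
    have hae : ∀ᵐ ω ∂μ, Tendsto (fun N : ℕ =>
        ZeroClustering.sectorFraction N (fun k => a N k ω) θ φ)
        atTop (𝓝 ((φ - θ) / (2 * Real.pi))) := by
      filter_upwards [hne', hL] with ω hω hLω
      exact ZeroClustering.tendsto_sectorFraction_atTop h0 h1.le h2 (b := fun N k => a N k ω) hω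
        (hLω.trans_isBigO hαO).tendsto_div_nhds_zero
    exact ⟨hae, fun p _ => ZeroClustering.tendstoInMean_of_tendstoInMeasure
      (fun N => hmeasS N _ _ h0 h2) (hbS θ φ)
      (tendstoInMeasure_of_tendsto_ae (fun N => hmeasS N _ _ h0 h2) hae) p⟩
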